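/- All arithmetic is over $\mathbb{Q}$. A head reads vectors $x_1,x_2,\dots\in\mathbb{Q}^D$ and keeps a matrix state $S_t\in\mathbb{Q}^{d\times d}$, $S_0=0$, with output $y_t=S_tq_t$. An RWKV-7 head has $$S_t=S_{t-1}\bigl(\operatorname{diag}(w_t)-\lambda_t\,\kappa_t(a_t\odot\kappa_t)^\top\bigr)+v_t\tilde k_t^\top,$$ and a DeltaNet head has $$S_t=S_{t-1}\bigl(I-\beta_tk_tk_t^\top\bigr)+\beta_tv_tk_t^\top,$$ where the vectors $w_t,a_t,\kappa_t,v_t,\tilde k_t,k_t,q_t\in\mathbb{Q}^d$ and the scalars $\lambda_t,\beta_t$ are linear projections of $x_t$. A layer consists of a multihead sublayer $x_t\mapsto x_t+O\langle y^1_t,\dots,y^h_t\rangle$ followed by a feedforward sublayer $x_t\mapsto x_t+W\,\mathrm{ReLU}(U\tilde x_t)$; both sublayers read the layer-normed input $\tilde x_t$ ($x_t$ minus its mean, divided by its standard deviation), where the square root is approximated by its degree-$m$ Taylor polynomial at $1$. An $L$-layer network embeds each token as a vector and applies $L$ such layers. It is run on $\$w$, where $\$$ is a beginning-of-sequence symbol,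 and its output is the final-layer vector at the last token. Matrices $A_1,\dots,A_n\in\{-1,0,1\}^{3\times3}$ are presented as the token stream of length $9n$ over $\{-1,0,1\}$ consisting of their entries, block by block and in row-major order. Let $P_n=A_1A_2\cdots A_n\in\mathbb{Z}^{3\times3}$. **Theorem.** There exist a $4$-layer RWKV-7 network and a $4$-layer DeltaNet network each of which solves the iterated $3\times3$ matrix multiplication problem: for each of the two networks there are nine fixed linear functionals $r_{ij}$ ($0\le i,j\le 2$) such that, for every $n\ge 0$ and all $A_1,\dots,A_n\in\{-1,0,1\}^{3\times3}$, applying $r_{ij}$ to the output of the network on the stream encoding $A_1,\dots,A_n$ gives $(P_n)_{ij}$. In particular, the network checks whether the $(0,0)$ entry of $P_n$ is positive: with the acceptance rule $r_{00}(\text{output})>0$ it recognizes exactly the language of those strings over $\{-1,0,1\}$ that encode some $A_1,\dots,A_n$ with $(P_n)_{00}>0$. The networks and functionals are independent of $n$, and the conclusions hold for every $m\ge 0$. -/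

import Mathlib

open Matrix

namespace LinearRNN

/-! ## Layer normalization over the rationals -/

/-- The Taylor polynomial of degree `m` of the square root at `1`:
`∑_{k ≤ m} binom(1/2, k) (x - 1)^k`. It plays the role of the square root over `ℚ`. -/
def taylorSqrt (m : ℕ) (x : ℚ) : ℚ :=
  ∑ k ∈ Finset.range (m + 1),
    ((∏ j ∈ Finset.range k, ((1 : ℚ) / 2 - (j : ℚ))) / (k.factorial : ℚ)) * (x - 1) ^ k

/-- The mean of the coordinates of a vector. -/
def mean {D : ℕ} (x : Fin D → ℚ) : ℚ := (∑ i, x i) / (D : ℚ)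

/-- The (population) variance of the coordinates of a vector. -/
def variance {D : ℕ} (x : Fin D → ℚ) : ℚ := (∑ i, (x i - mean x) ^ 2) / (D : ℚ)

/-- Layer norm: subtract the mean and divide by the standard deviation, the square root being
approximated by its Taylor polynomial of degree `m`. -/
def layerNorm (m : ℕ) {D : ℕ} (x : Fin D → ℚ) : Fin D → ℚ :=
  fun i => (x i - mean x) / taylorSqrt m (variance x)

/-! ## Heads

A head reads a sequence `x 0, x 1, x 2, …` of vectors of dimension `D`, keeps a `d × d` matrix
state (initially zero), and emits one vector of dimension `d` per position. All per-token
quantities are linear projections of the current input vector. Vectors act as columns, so that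
`Matrix.vecMulVec u v` is the outer product `u vᵀ`. -/

/-- The projections of an RWKV-7 head. -/
structure RWKV7Head (D d : ℕ) where
  w : Matrix (Fin d) (Fin D) ℚ
  a : Matrix (Fin d) (Fin D) ℚ
  kappa : Matrix (Fin d) (Fin D) ℚ
  lam : Fin D → ℚ
  v : Matrix (Fin d) (Fin D) ℚ
  ktilde : Matrix (Fin d) (Fin D) ℚ
  q : Matrix (Fin d) (Fin D) ℚ

namespace RWKV7Head

variable {D d : ℕ}

/-- The transition matrix `diag(w) - λ κ (a ⊙ κ)ᵀ` for the input vector `x`. -/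
def transition (h : RWKV7Head D d) (x : Fin D → ℚ) : Matrix (Fin d) (Fin d) ℚ :=
  Matrix.diagonal (h.w *ᵥ x) -
    (h.lam ⬝ᵥ x) • Matrix.vecMulVec (h.kappa *ᵥ x) ((h.a *ᵥ x) * (h.kappa *ᵥ x))

/-- The state after the first `t` inputs: `S ↦ S (diag(w) - λ κ (a ⊙ κ)ᵀ) + v k̃ᵀ`. -/
def state (h : RWKV7Head D d) (x : ℕ → Fin D → ℚ) : ℕ → Matrix (Fin d) (Fin d) ℚ
  | 0 => 0
  | t + 1 => state h x t * h.transition (x t) +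
      Matrix.vecMulVec (h.v *ᵥ x t) (h.ktilde *ᵥ x t)

/-- The output at position `t`: the state that includes the update of position `t`, applied to
the query of position `t`. -/
def run (h : RWKV7Head D d) (x : ℕ → Fin D → ℚ) (t : ℕ) : Fin d → ℚ :=
  h.state x (t + 1) *ᵥ (h.q *ᵥ x t)

end RWKV7Head

/-- The projections of a DeltaNet head. -/
structure DeltaNetHead (D d : ℕ) where
  beta : Fin D → ℚ
  k : Matrix (Fin d) (Fin D) ℚ
  v : Matrix (Fin d) (Fin D) ℚ
  q : Matrix (Fin d) (Fin D) ℚ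

namespace DeltaNetHead

variable {D d : ℕ}

/-- The transition matrix `I - β k kᵀ` for the input vector `x`. -/
def transition (h : DeltaNetHead D d) (x : Fin D → ℚ) : Matrix (Fin d) (Fin d) ℚ :=
  1 - (h.beta ⬝ᵥ x) • Matrix.vecMulVec (h.k *ᵥ x) (h.k *ᵥ x)

/-- The state after the first `t` inputs: `S ↦ S (I - β k kᵀ) + β v kᵀ`. -/
def state (h : DeltaNetHead D d) (x : ℕ → Fin D → ℚ) : ℕ → Matrix (Fin d) (Fin d) ℚ
  | 0 => 0
  | t + 1 => state h x t * h.transition (x t) +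
      (h.beta ⬝ᵥ x t) • Matrix.vecMulVec (h.v *ᵥ x t) (h.k *ᵥ x t)

/-- The output at position `t`: the state that includes the update of position `t`, applied to
the query of position `t`. -/
def run (h : DeltaNetHead D d) (x : ℕ → Fin D → ℚ) (t : ℕ) : Fin d → ℚ :=
  h.state x (t + 1) *ᵥ (h.q *ᵥ x t)

end DeltaNetHead

/-- A type of heads (indexed by input dimension and head dimension) with its semantics as a map
from input sequences to output sequences. -/
class HeadType (Head : ℕ → ℕ → Type) where
  run : {D d : ℕ} → Head D d → (ℕ → Fin D → ℚ) → ℕ → Fin d → ℚ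

instance : HeadType RWKV7Head := ⟨RWKV7Head.run⟩

instance : HeadType DeltaNetHead := ⟨DeltaNetHead.run⟩

/-! ## Layers and networks -/

/-- One layer: a multihead recurrent sublayer followed by a feedforward sublayer. -/
structure Layer (Head : ℕ → ℕ → Type) (D : ℕ) where
  /-- number of heads -/
  numHeads : ℕ
  /-- dimension of each head -/
  headDim : ℕ
  heads : Fin numHeads → Head D headDim
  /-- output projection applied to the concatenation of the head outputs -/
  O : Matrix (Fin D) (Fin numHeads × Fin headDim) ℚ
  /-- width of the feedforward sublayer -/
  width : ℕ
  U : Matrix (Fin width) (Fin D) ℚ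
  W : Matrix (Fin D) (Fin width) ℚ

namespace Layer

variable {Head : ℕ → ℕ → Type} [HeadType Head] {D : ℕ}

/-- The multihead sublayer `x_t ↦ x_t + O ⟨y_1, …, y_h⟩`, the heads reading the layer-normed
sequence. -/
def mix (L : Layer Head D) (m : ℕ) (x : ℕ → Fin D → ℚ) : ℕ → Fin D → ℚ :=
  fun t => x t + L.O *ᵥ
    (fun p : Fin L.numHeads × Fin L.headDim =>
      HeadType.run (L.heads p.1) (fun s => layerNorm m (x s)) t p.2)

/-- The feedforward sublayer `x_t ↦ x_t + W ReLU(U x̃_t)`, where `x̃_t` is the layer-normed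
input. -/
def feedforward (L : Layer Head D) (m : ℕ) (x : ℕ → Fin D → ℚ) : ℕ → Fin D → ℚ :=
  fun t => x t + L.W *ᵥ (fun i => max ((L.U *ᵥ layerNorm m (x t)) i) 0)

/-- The sequence map computed by a layer. -/
def apply (L : Layer Head D) (m : ℕ) (x : ℕ → Fin D → ℚ) : ℕ → Fin D → ℚ :=
  L.feedforward m (L.mix m x)

end Layer

/-- A network with `numLayers` layers over the alphabet `Tok`. Its input tokens are
`Option Tok`, where `none` is the beginning-of-sequence symbol. -/
structure Network (Head : ℕ → ℕ → Type) (Tok : Type) (numLayers : ℕ) where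
  /-- dimension of the residual stream -/
  dim : ℕ
  embed : Option Tok → Fin dim → ℚ
  layers : Fin numLayers → Layer Head dim

/-- The token at position `t` of the string `$w`. Positions beyond the end of `$w` hold a dummy
token; networks are causal and read out at the last token of `$w`, so these are irrelevant. -/
def tokenAt {Tok : Type} (w : List Tok) (t : ℕ) : Option Tok :=
  (none :: w.map some).getD t none

namespace Network

variable {Head : ℕ → ℕ → Type} [HeadType Head] {Tok : Type} {numLayers : ℕ}

/-- The residual stream after the last layer, on input `$w`. -/
def stream (net : Network Head Tok numLayers) (m : ℕ) (w : List Tok) :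
    ℕ → Fin net.dim → ℚ :=
  (List.ofFn net.layers).foldl (fun x L => L.apply m x) (fun t => net.embed (tokenAt w t))

/-- The final-layer output at the last token of `$w`. -/
def output (net : Network Head Tok numLayers) (m : ℕ) (w : List Tok) : Fin net.dim → ℚ :=
  net.stream m w w.length

/-- The language recognized by a network with linear acceptance functional `o`: the string `w`
is accepted iff `oᵀ y > 0`, where `y` is the output at the last token of `$w`. -/
def language (net : Network Head Tok numLayers) (m : ℕ) (o : Fin net.dim → ℚ) :
    Language Tok :=
  {w | 0 < o ⬝ᵥ net.output m w}

end Network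

/-! ## Iterated `3 × 3` matrix multiplication

The alphabet `{-1, 0, 1}` is `SignType`. -/

/-- The block of nine tokens that encodes a matrix, in row-major order. -/
def encodeMatrix (A : Matrix (Fin 3) (Fin 3) SignType) : List SignType :=
  [A 0 0, A 0 1, A 0 2, A 1 0, A 1 1, A 1 2, A 2 0, A 2 1, A 2 2]

/-- The token stream that encodes a sequence of matrices. -/
def encodeStream (As : List (Matrix (Fin 3) (Fin 3) SignType)) : List SignType :=
  As.flatMap encodeMatrix

/-- The product `A₁ A₂ ⋯ A_n` over the integers. -/
def iteratedProduct (As : List (Matrix (Fin 3) (Fin 3) SignType)) :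
    Matrix (Fin 3) (Fin 3) ℤ :=
  (As.map fun A => A.map fun s : SignType => (s : ℤ)).prod

/-- The streams that encode a sequence of matrices whose product has a positive `(0,0)` entry. -/
def positiveProductLanguage : Language SignType :=
  {w | ∃ As, w = encodeStream As ∧ 0 < iteratedProduct As 0 0}

/-- The network `net`, whatever the degree of the square root approximation in its layer norms,
computes the iterated product: a fixed linear readout `R` of its output at the last token has
the nine entries of the product as its coordinates, and the readout of the `(0,0)` entry, as an
acceptance functional, recognizes the language of positivity of that entry. -/
def SolvesIteratedProduct {Head : ℕ → ℕ → Type} [HeadType Head] {numLayers : ℕ}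
    (net : Network Head SignType numLayers) : Prop :=
  ∃ R : Matrix (Fin 3 × Fin 3) (Fin net.dim) ℚ, ∀ m : ℕ,
    (∀ (As : List (Matrix (Fin 3) (Fin 3) SignType)) (i j : Fin 3),
      (R *ᵥ net.output m (encodeStream As)) (i, j) = (iteratedProduct As i j : ℚ)) ∧
    net.language m (R (0, 0)) = positiveProductLanguage

end LinearRNN

namespace LinearRNN

/-! ## Scalar heads driven by a finite-state sequence -/

/-! Both head types can run the one-row delta rule `r ↦ r + β (v - r ⬝ᵥ k) k` with coefficients that
are arbitrary functions of a symbol from a finite set. It therefore suffices to build one network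
from such scalar heads (`RealizesScalarHeads`).

The residual stream holds `(f, -f)`, where `f` is a vector of signs encoding a symbol. Such a vector
has mean 0 and variance 1, and every Taylor polynomial of the square root is 1 at 1, so layer norm
fixes it whatever `m` is (`layerNorm_balanced`). Every function of the symbol is a linear functional
of this vector, and a feedforward sublayer with one neuron per sign vector is a lookup table. A
layer can thus replace the symbol by any function of it and of bits computed by heads
(`exists_layer_update`).

For `k = e_a - e_b` and `β = 1`, the delta rule with `v = 0` swaps two coordinates, so heads can
count by composing transpositions. The first layer finds the parity of the position. The second uses
parity to drive counters of periods 6 and 4, giving the position modulo 12. The third uses this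
residue to drive a counter of period 9, and also as an address in a cyclic memory of the last twelve
tokens.

In the last layer, the head for entry `(i, j)` carries row `i` of a partial product in the left half
of a six-dimensional row. Nine symmetric rank-one updates multiply it by a given matrix
(`deltaStep_productStep`), exactly the number of steps in a block. A block is known only once it has
ended, so its matrix is applied during the next block, and the matrix of the final block enters
through the query (`productHead_out`).

All claims about sequences are limited to positions up to the last token, since the dummy tokens
beyond it look like `$`. -/

/-- A delta-rule head with a single row of state, whose parameters are arbitrary functions of the
current symbol. -/
structure ScalarHead (σ ι : Type) where
  beta : σ → ℚ
  k : σ → ι → ℚ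
  v : σ → ℚ
  q : σ → ι → ℚ

namespace ScalarHead

variable {σ ι : Type} [Fintype ι]

/-- The row state after the first `t` symbols. -/
def row (h : ScalarHead σ ι) (s : ℕ → σ) : ℕ → ι → ℚ
  | 0 => 0
  | t + 1 => row h s t +
      (h.beta (s t) * (h.v (s t) - row h s t ⬝ᵥ h.k (s t))) • h.k (s t)

/-- The output at position `t`. -/
def out (h : ScalarHead σ ι) (s : ℕ → σ) (t : ℕ) : ℚ :=
  h.row s (t + 1) ⬝ᵥ h.q (s t)

end ScalarHead

/-- A head type is universal if it realizes every scalar head on every input sequence from which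
the functions of the current symbol can be read off linearly. -/
def RealizesScalarHeads (Head : ℕ → ℕ → Type) [HeadType Head] : Prop :=
  ∀ (D : ℕ) (σ ι : Type) [Fintype ι] (read : (σ → ℚ) → Fin D → ℚ) (sh : ScalarHead σ ι),
    ∃ h : Head D (Fintype.card ι), ∀ (x : ℕ → Fin D → ℚ) (s : ℕ → σ) (N : ℕ),
      (∀ t ≤ N, ∀ g, read g ⬝ᵥ x t = g (s t)) →
        ∀ t ≤ N, ∀ i, HeadType.run h x t i = sh.out s t

/-- All rows of the matrix state receive the same value, so each row is a copy of the scalar head's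
row. -/
theorem deltaNet_realizesScalarHeads : RealizesScalarHeads DeltaNetHead := by
  intro D σ ι _ read sh
  let e := (Fintype.equivFin ι).symm
  let h : DeltaNetHead D (Fintype.card ι) :=
    { beta := read sh.beta
      k := fun i => read (fun s => sh.k s (e i))
      v := fun _ => read sh.v
      q := fun i => read (fun s => sh.q s (e i)) }
  refine ⟨h, fun x s N hx => ?_⟩
  have hk : ∀ t ≤ N, h.k *ᵥ x t = fun i => sh.k (s t) (e i) := fun t ht =>
    funext fun i => hx t ht (fun s => sh.k s (e i))
  have hv : ∀ t ≤ N, h.v *ᵥ x t = fun _ => sh.v (s t) := fun t ht => funext fun i => hx t ht sh.v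
  have hq : ∀ t ≤ N, h.q *ᵥ x t = fun i => sh.q (s t) (e i) := fun t ht =>
    funext fun i => hx t ht (fun s => sh.q s (e i))
  have hb : ∀ t ≤ N, h.beta ⬝ᵥ x t = sh.beta (s t) := fun t ht => hx t ht sh.beta
  have hstate : ∀ t ≤ N + 1, h.state x t = Matrix.of fun _ j => sh.row s t (e j) := by
    intro t
    induction t with
    | zero => intro _; rfl
    | succ t ih =>
      intro ht
      have ht' : t ≤ N := by omega
      rw [DeltaNetHead.state, ih (by omega), DeltaNetHead.transition, hk t ht', hv t ht',
        hb t ht', Matrix.mul_sub, Matrix.mul_one, Matrix.mul_smul]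
      ext i j
      simp only [ScalarHead.row, Matrix.add_apply, Matrix.sub_apply, Matrix.smul_apply,
        Matrix.mul_apply, Matrix.vecMulVec_apply, Matrix.of_apply, Pi.add_apply, Pi.smul_apply,
        smul_eq_mul, ← mul_assoc, ← Finset.sum_mul]
      have hdot : ∑ i, sh.row s t (e i) * sh.k (s t) (e i) = sh.row s t ⬝ᵥ sh.k (s t) :=
        e.sum_comp (fun i => sh.row s t i * sh.k (s t) i)
      rw [hdot]
      ring
  intro t ht i
  change (h.state x (t + 1) *ᵥ (h.q *ᵥ x t)) i = _
  rw [hstate (t + 1) (by omega), hq t ht]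
  exact e.sum_comp (fun i => sh.row s (t + 1) i * sh.q (s t) i)

/-- With `w = a = 1`, `κ = k̃ = k` and `λ = β`, the transition becomes `I - β k kᵀ`. The factor `β`
of the written value is absorbed into `v`, which is possible because `v` may be any function of the
symbol. -/
theorem rwkv7_realizesScalarHeads : RealizesScalarHeads RWKV7Head := by
  intro D σ ι _ read sh
  let e := (Fintype.equivFin ι).symm
  let h : RWKV7Head D (Fintype.card ι) :=
    { w := fun _ => read (fun _ => 1)
      a := fun _ => read (fun _ => 1)
      kappa := fun i => read (fun s => sh.k s (e i))
      lam := read sh.beta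
      v := fun _ => read (fun s => sh.beta s * sh.v s)
      ktilde := fun i => read (fun s => sh.k s (e i))
      q := fun i => read (fun s => sh.q s (e i)) }
  refine ⟨h, fun x s N hx => ?_⟩
  have hdiag : Matrix.diagonal (1 : Fin (Fintype.card ι) → ℚ) = 1 := Matrix.diagonal_one
  have hw : ∀ t ≤ N, h.w *ᵥ x t = 1 := fun t ht => funext fun i => hx t ht (fun _ => 1)
  have hk : ∀ t ≤ N, h.kappa *ᵥ x t = fun i => sh.k (s t) (e i) := fun t ht =>
    funext fun i => hx t ht (fun s => sh.k s (e i))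
  have hv : ∀ t ≤ N, h.v *ᵥ x t = fun _ => sh.beta (s t) * sh.v (s t) := fun t ht =>
    funext fun i => hx t ht (fun s => sh.beta s * sh.v s)
  have hq : ∀ t ≤ N, h.q *ᵥ x t = fun i => sh.q (s t) (e i) := fun t ht =>
    funext fun i => hx t ht (fun s => sh.q s (e i))
  have hb : ∀ t ≤ N, h.lam ⬝ᵥ x t = sh.beta (s t) := fun t ht => hx t ht sh.beta
  have hstate : ∀ t ≤ N + 1, h.state x t = Matrix.of fun _ j => sh.row s t (e j) := by
    intro t
    induction t with
    | zero => intro _; rfl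
    | succ t ih =>
      intro ht
      have ht' : t ≤ N := by omega
      rw [RWKV7Head.state, ih (by omega), RWKV7Head.transition, hk t ht', hv t ht',
        hb t ht', hw t ht', hdiag, one_mul, Matrix.mul_sub,
        Matrix.mul_one, Matrix.mul_smul]
      ext i j
      simp only [ScalarHead.row, Matrix.add_apply, Matrix.sub_apply, Matrix.smul_apply,
        Matrix.mul_apply, Matrix.vecMulVec_apply, Matrix.of_apply, Pi.add_apply, Pi.smul_apply,
        smul_eq_mul, ← mul_assoc, ← Finset.sum_mul]
      have hdot : ∑ i, sh.row s t (e i) * sh.k (s t) (e i) = sh.row s t ⬝ᵥ sh.k (s t) :=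
        e.sum_comp (fun i => sh.row s t i * sh.k (s t) i)
      rw [hdot]
      ring
  intro t ht i
  change (h.state x (t + 1) *ᵥ (h.q *ᵥ x t)) i = _
  rw [hstate (t + 1) (by omega), hq t ht]
  exact e.sum_comp (fun i => sh.row s (t + 1) i * sh.q (s t) i)

/-! ## Balanced sign vectors in the residual stream -/

section Stream

/-- Coordinates of the residual stream, up to sign: a constant, a one-hot symbol, output slots. -/
abbrev Coord (σ H : Type) : Type := Option (σ ⊕ H)

/-- The dimension of the residual stream. -/
abbrev streamDim (σ H : Type) [Fintype σ] [Fintype H] : ℕ := Fintype.card (Bool × Coord σ H)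

variable {σ H : Type}

section Features

variable [DecidableEq σ]

/-- The sign vector of a symbol, with the values `y` in the output slots. -/
def features (s : σ) (y : H → ℚ) : Coord σ H → ℚ
  | none => 1
  | some (Sum.inl c) => if c = s then 1 else -1
  | some (Sum.inr h) => 1 - 2 * y h

/-- Output values of a family of bits. -/
def bitValue (y : H → Bool) : H → ℚ := fun h => if y h then 1 else 0

theorem features_sq (s : σ) (y : H → Bool) (c : Coord σ H) : features s (bitValue y) c ^ 2 = 1 := by
  rcases c with _ | c | h
  · simp [features]
  · simp only [features]; split_ifs <;> norm_num
  · simp only [features, bitValue]; split_ifs <;> norm_num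

theorem bitValue_false : bitValue (fun _ : H => false) = 0 := by
  ext h; simp [bitValue]

/-- The sign vector of a symbol together with a family of bits. -/
def signVector (n : σ × (H → Bool)) : Coord σ H → ℚ := features n.1 (bitValue n.2)

theorem signVector_injective : Function.Injective (signVector (σ := σ) (H := H)) := by
  rintro ⟨s, y⟩ ⟨s', y'⟩ h
  have hs : s = s' := by
    have := congrFun h (some (Sum.inl s))
    simp only [signVector, features, if_true] at this
    by_contra hne
    rw [if_neg hne] at this
    norm_num at this
  have hy : y = y' := by
    ext i
    have := congrFun h (some (Sum.inr i))
    simp only [signVector, features, bitValue] at this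
    cases hi : y i <;> cases hi' : y' i <;> simp [hi, hi'] at this ⊢
    norm_num at this
  rw [hs, hy]

end Features

variable [Fintype σ] [Fintype H]

/-- The signed coordinate at a given index of the residual stream. -/
noncomputable def coordAt : Fin (streamDim σ H) ≃ Bool × Coord σ H :=
  (Fintype.equivFin (Bool × Coord σ H)).symm

/-- The vector `(f, -f)`. -/
noncomputable def balanced (f : Coord σ H → ℚ) : Fin (streamDim σ H) → ℚ := fun c =>
  if (coordAt c).1 then f (coordAt c).2 else -f (coordAt c).2

/-- The functional that reads `g ⬝ᵥ f` off `(f, -f)`. -/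
noncomputable def functional (g : Coord σ H → ℚ) : Fin (streamDim σ H) → ℚ := fun c =>
  if (coordAt c).1 then g (coordAt c).2 else 0

theorem sum_coordAt (F : Bool × Coord σ H → ℚ) :
    ∑ c : Fin (streamDim σ H), F (coordAt c) = ∑ c, F (true, c) + ∑ c, F (false, c) := by
  rw [coordAt.sum_comp F, Fintype.sum_prod_type]
  simp

theorem functional_dotProduct_balanced (g f : Coord σ H → ℚ) :
    functional g ⬝ᵥ balanced f = g ⬝ᵥ f := by
  have := sum_coordAt (σ := σ) (H := H) (fun p => (if p.1 then g p.2 else 0) *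
    (if p.1 then f p.2 else -f p.2))
  simpa [dotProduct, functional, balanced] using this

theorem balanced_add (f g : Coord σ H → ℚ) : balanced (f + g) = balanced f + balanced g := by
  ext c
  simp only [balanced, Pi.add_apply]
  split_ifs <;> ring

theorem balanced_sum_smul {α : Type} [Fintype α] (a : α → ℚ) (f : α → Coord σ H → ℚ) (c) :
    ∑ i, balanced (f i) c * a i = balanced (fun c => ∑ i, f i c * a i) c := by
  simp only [balanced]
  split_ifs <;> simp

theorem taylorSqrt_one (m : ℕ) : taylorSqrt m 1 = 1 := by
  unfold taylorSqrt
  rw [Finset.sum_eq_single_of_mem 0 (by simp)]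
  · simp
  · intro k _ hk
    simp [hk]

/-- The two halves cancel in the mean and all squares are 1, so the square root is only evaluated at
1, where its approximation is exact. -/
theorem layerNorm_balanced (m : ℕ) (f : Coord σ H → ℚ) (hf : ∀ c, f c ^ 2 = 1) :
    layerNorm m (balanced f) = balanced f := by
  have hmean : mean (balanced f) = 0 := by
    have := sum_coordAt (σ := σ) (H := H) (fun p => if p.1 then f p.2 else -f p.2)
    simp only [mean, balanced]
    rw [this]
    simp only [if_true, Bool.false_eq_true, if_false, Finset.sum_neg_distrib, add_neg_cancel,
      zero_div]
  have hvar : variance (balanced f) = 1 := by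
    have hsq : ∀ c, (balanced f c - mean (balanced f)) ^ 2 = 1 := by
      intro c
      rw [hmean, sub_zero]
      unfold balanced
      split_ifs
      · exact hf _
      · rw [neg_sq]; exact hf _
    have hpos : (streamDim σ H : ℚ) ≠ 0 := by
      exact_mod_cast Fintype.card_ne_zero
    simp only [variance, hsq]
    simpa using div_self hpos
  ext c
  simp [layerNorm, hmean, hvar, taylorSqrt_one]

variable [DecidableEq σ]

/-- The functional that reads a function of the symbol. -/
noncomputable def readSymbol (g : σ → ℚ) : Fin (streamDim σ H) → ℚ :=
  functional fun
    | none => (∑ s, g s) / 2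
    | some (Sum.inl c) => g c / 2
    | some (Sum.inr _) => 0

/-- The indicator of `c = s` is `(1 + x_c) / 2` for the sign `x_c`; the constant halves are
collected on the constant coordinate. -/
theorem readSymbol_dotProduct (g : σ → ℚ) (s : σ) (y : H → ℚ) :
    readSymbol g ⬝ᵥ balanced (features s y) = g s := by
  rw [readSymbol, functional_dotProduct_balanced]
  simp only [dotProduct, Fintype.sum_option, Fintype.sum_sum_type, features]
  have : ∀ c, g c / 2 * (if c = s then (1 : ℚ) else -1) = (if c = s then g c else 0) - g c / 2 := by
    intro c; split_ifs <;> ring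
  simp only [this, Finset.sum_sub_distrib, Finset.sum_ite_eq', Finset.mem_univ, if_true,
    ← Finset.sum_div]
  simp

theorem signVector_dotProduct_self (n : σ × (H → Bool)) :
    signVector n ⬝ᵥ signVector n = Fintype.card (Coord σ H) := by
  simp [dotProduct, ← sq, signVector, features_sq]

variable [DecidableEq H]

/-- The functional that reads an output slot. -/
noncomputable def readOutput (h : H) : Fin (streamDim σ H) → ℚ :=
  functional fun
    | none => 1 / 2
    | some (Sum.inl _) => 0
    | some (Sum.inr h') => if h' = h then -1 / 2 else 0

theorem readOutput_dotProduct (h : H) (s : σ) (y : H → ℚ) :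
    readOutput h ⬝ᵥ balanced (features s y) = y h := by
  rw [readOutput, functional_dotProduct_balanced]
  simp only [dotProduct, Fintype.sum_option, Fintype.sum_sum_type, features]
  simp
  ring

/-! ## Layers acting on symbols -/

/-- Some coordinate has opposite signs and contributes at most 0, every other one at most 1. This
gap separates a sign vector from all the others by a threshold. -/
theorem signVector_dotProduct_le {n n' : σ × (H → Bool)} (hne : n ≠ n') :
    signVector n ⬝ᵥ signVector n' ≤ Fintype.card (Coord σ H) - 1 := by
  obtain ⟨c, hc⟩ := Function.ne_iff.mp (signVector_injective.ne hne)
  have h1 : ∀ c, (signVector n c) ^ 2 = 1 := features_sq _ _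
  have h2 : ∀ c, (signVector n' c) ^ 2 = 1 := features_sq _ _
  have hle : ∀ c, signVector n c * signVector n' c ≤ 1 := fun c => by
    nlinarith [h1 c, h2 c, sq_nonneg (signVector n c - signVector n' c)]
  have hcle : signVector n c * signVector n' c ≤ 0 := by
    rcases sq_eq_one_iff.mp (h1 c) with h | h <;>
    rcases sq_eq_one_iff.mp (h2 c) with h' | h' <;> simp [h, h'] at hc ⊢
  rw [dotProduct, ← Finset.add_sum_erase _ _ (Finset.mem_univ c)]
  have : ∑ x ∈ Finset.univ.erase c, signVector n x * signVector n' x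
      ≤ ∑ x ∈ Finset.univ.erase c, (1 : ℚ) := Finset.sum_le_sum fun x _ => hle x
  rw [Finset.sum_const, Finset.card_erase_of_mem (Finset.mem_univ c), Finset.card_univ,
    nsmul_eq_mul, mul_one, Nat.cast_sub Fintype.card_pos] at this
  push_cast at this ⊢
  linarith

/-- Enumeration of the sign vectors. -/
noncomputable def signIndex : Fin (Fintype.card (σ × (H → Bool))) ≃ σ × (H → Bool) :=
  (Fintype.equivFin (σ × (H → Bool))).symm

/-- One neuron per sign vector, which fires on exactly this vector. -/
noncomputable def detectors :
    Matrix (Fin (Fintype.card (σ × (H → Bool)))) (Fin (streamDim σ H)) ℚ :=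
  Matrix.of fun n => functional fun c => signVector (signIndex n) c -
    if c = none then ((Fintype.card (Coord σ H) : ℚ) - 1) else 0

/-- The threshold, one less than the number of coordinates, is carried by the constant coordinate: a
match exceeds it by exactly 1, and a mismatch does not exceed it. -/
theorem relu_detectors (n : σ × (H → Bool)) (i : Fin (Fintype.card (σ × (H → Bool)))) :
    max ((detectors *ᵥ balanced (signVector n)) i) 0 = if signIndex i = n then 1 else 0 := by
  have hval : (detectors *ᵥ balanced (signVector n)) i =
      signVector (signIndex i) ⬝ᵥ signVector n - ((Fintype.card (Coord σ H) : ℚ) - 1) := by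
    have hi : (detectors *ᵥ balanced (signVector n)) i =
        functional (fun c => signVector (signIndex i) c -
          if c = none then ((Fintype.card (Coord σ H) : ℚ) - 1) else 0) ⬝ᵥ
        balanced (signVector n) := rfl
    rw [hi, functional_dotProduct_balanced]
    simp only [dotProduct, sub_mul, Finset.sum_sub_distrib, ite_mul, zero_mul,
      Finset.sum_ite_eq', Finset.mem_univ, if_true]
    simp [signVector, features]
  rw [hval]
  split_ifs with h
  · rw [h, signVector_dotProduct_self]; simp
  · exact max_eq_right (by linarith [signVector_dotProduct_le h])

/-- The output weights that replace each sign vector by the encoding of a given symbol. -/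
noncomputable def updates (G : σ → (H → Bool) → σ) :
    Matrix (Fin (streamDim σ H)) (Fin (Fintype.card (σ × (H → Bool)))) ℚ :=
  Matrix.of fun c i => balanced
    (features (G (signIndex i).1 (signIndex i).2) 0 - signVector (signIndex i)) c

theorem updates_mulVec (G : σ → (H → Bool) → σ) (n : σ × (H → Bool)) :
    updates G *ᵥ (fun i => if signIndex i = n then 1 else 0) =
      balanced (features (G n.1 n.2) 0 - signVector n) := by
  ext c
  refine (signIndex.sum_comp (fun n' => balanced (features (G n'.1 n'.2) 0 - signVector n') c *
    if n' = n then 1 else 0)).trans ?_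
  simp

variable (Head : ℕ → ℕ → Type) [HeadType Head]

/-- The heads of `heads`, realized in a layer that writes their outputs to the output slots, with
a given feedforward sublayer. -/
theorem exists_layer_mix (hH : RealizesScalarHeads Head) {ι : Type} [Fintype ι] [Nonempty ι]
    (heads : H → ScalarHead σ ι) (width : ℕ) (U : Matrix (Fin width) (Fin (streamDim σ H)) ℚ)
    (W : Matrix (Fin (streamDim σ H)) (Fin width) ℚ) :
    ∃ L : Layer Head (streamDim σ H),
      (∀ m x, L.apply m x = fun t => L.mix m x t +
        W *ᵥ (fun i => max ((U *ᵥ layerNorm m (L.mix m x t)) i) 0)) ∧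
      ∀ (m : ℕ) (x : ℕ → Fin (streamDim σ H) → ℚ) (s : ℕ → σ) (N : ℕ),
        (∀ t ≤ N, x t = balanced (features (s t) 0)) →
        ∀ t ≤ N, L.mix m x t = balanced (features (s t) fun h => (heads h).out s t) := by
  choose hd hhd using fun h => hH (streamDim σ H) σ ι readSymbol (heads h)
  let e := (Fintype.equivFin H).symm
  let i₀ : Fin (Fintype.card ι) := ⟨0, Fintype.card_pos⟩
  let L : Layer Head (streamDim σ H) :=
    { numHeads := Fintype.card H
      headDim := Fintype.card ι
      heads := fun i => hd (e i)
      -- Heads are constant across their coordinates, so only coordinate `i₀` is used. The factor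
      -- `-2` matches the encoding `1 - 2 * y` of the output slots.
      O := fun c p => balanced (fun c' =>
        if p.2 = i₀ ∧ c' = some (Sum.inr (e p.1)) then -2 else 0) c
      width := width
      U := U
      W := W }
  refine ⟨L, fun m x => rfl, fun m x s N hx t ht => ?_⟩
  have hln : ∀ t ≤ N, layerNorm m (x t) = balanced (features (s t) 0) := by
    intro t ht
    rw [hx t ht, ← bitValue_false]
    exact layerNorm_balanced m _ (features_sq _ _)
  have hrun : ∀ h i, HeadType.run (hd h) (fun s => layerNorm m (x s)) t i = (heads h).out s t :=
    fun h i => hhd h _ s N (fun t ht g => by rw [hln t ht, readSymbol_dotProduct]) t ht i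
  have hfeat : features (s t) (fun h => (heads h).out s t) = features (s t) 0 +
      fun c => ∑ p : Fin (Fintype.card H) × Fin (Fintype.card ι),
        (if p.2 = i₀ ∧ c = some (Sum.inr (e p.1)) then (-2 : ℚ) else 0) *
          (heads (e p.1)).out s t := by
    ext c
    rw [Pi.add_apply, Fintype.sum_prod_type]
    have hinner : ∀ a, ∑ b, (if b = i₀ ∧ c = some (Sum.inr (e a)) then (-2 : ℚ) else 0) *
        (heads (e a)).out s t = if c = some (Sum.inr (e a)) then
          -2 * (heads (e a)).out s t else 0 := by
      intro a
      rw [Finset.sum_eq_single i₀]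
      · simp
      · intro b _ hb; simp [hb]
      · simp
    simp only [hinner]
    rw [e.sum_comp (fun h => if c = some (Sum.inr h) then -2 * (heads h).out s t else 0)]
    rcases c with _ | c | h
    · simp [features]
    · simp [features]
    · simp [features]; ring
  rw [hfeat, balanced_add, ← hx t ht]
  unfold Layer.mix
  congr 1
  ext c
  simp only [L, hrun, Matrix.mulVec, dotProduct]
  exact balanced_sum_smul _ _ c

/-- A layer that updates the symbol by an arbitrary function of the symbol and of bits computed by
scalar heads. -/
theorem exists_layer_update (hH : RealizesScalarHeads Head) {ι : Type} [Fintype ι] [Nonempty ι]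
    (heads : H → ScalarHead σ ι) (G : σ → (H → Bool) → σ) :
    ∃ L : Layer Head (streamDim σ H),
      ∀ (m : ℕ) (x : ℕ → Fin (streamDim σ H) → ℚ) (s : ℕ → σ) (y : ℕ → H → Bool) (N : ℕ),
        (∀ t ≤ N, x t = balanced (features (s t) 0)) →
        (∀ t ≤ N, ∀ h, (heads h).out s t = if y t h then 1 else 0) →
        ∀ t ≤ N, L.apply m x t = balanced (features (G (s t) (y t)) 0) := by
  obtain ⟨L, hL, hmix⟩ := exists_layer_mix Head hH heads _ detectors (updates G)
  refine ⟨L, fun m x s y N hx hy t ht => ?_⟩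
  have hmixt : L.mix m x t = balanced (signVector (s t, y t)) := by
    rw [hmix m x s N hx t ht]
    congr 2
    exact funext fun h => hy t ht h
  rw [hL]
  simp only
  rw [hmixt, layerNorm_balanced m (signVector (s t, y t)) (features_sq _ _)]
  simp only [relu_detectors]
  rw [updates_mulVec, ← balanced_add]
  congr 1
  exact add_sub_cancel _ _

/-- A layer that writes the outputs of scalar heads to the output slots. -/
theorem exists_layer_output (hH : RealizesScalarHeads Head) {ι : Type} [Fintype ι] [Nonempty ι]
    (heads : H → ScalarHead σ ι) :
    ∃ L : Layer Head (streamDim σ H),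
      ∀ (m : ℕ) (x : ℕ → Fin (streamDim σ H) → ℚ) (s : ℕ → σ) (N : ℕ),
        (∀ t ≤ N, x t = balanced (features (s t) 0)) →
        ∀ t ≤ N, L.apply m x t = balanced (features (s t) fun h => (heads h).out s t) := by
  obtain ⟨L, hL, hmix⟩ := exists_layer_mix Head hH heads 0 0 0
  refine ⟨L, fun m x s N hx t ht => ?_⟩
  rw [hL]
  simp only [Matrix.zero_mulVec, add_zero]
  exact hmix m x s N hx t ht

end Stream

/-! ## Counting and remembering with scalar heads -/

section Memory

variable {σ ι : Type} [Fintype ι] [DecidableEq ι]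

/-- A head that tracks the position of a token, initially at `i₀`, under a sequence of
transpositions, and tells whether it is at `i`. -/
def swapHead (start : σ → Bool) (drive : σ → ι × ι) (i₀ i : ι) : ScalarHead σ ι where
  beta _ := 1
  k s := if start s then Pi.single i₀ 1 else Pi.single (drive s).1 1 - Pi.single (drive s).2 1
  v s := if start s then 1 else 0
  q _ := Pi.single i 1

/-- For `a ≠ b` the vector `e_a - e_b` has squared norm 2, so `I - k kᵀ` is the reflection that
swaps the two coordinates. For `a = b` it is the identity, so a counter can also idle. -/
theorem reflect_single (a b p : ι) :
    (Pi.single p 1 : ι → ℚ) +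
      (1 * (0 - (Pi.single p 1 : ι → ℚ) ⬝ᵥ (Pi.single a 1 - Pi.single b 1))) •
        (Pi.single a 1 - Pi.single b 1) = Pi.single (Equiv.swap a b p) 1 := by
  ext j
  rw [single_one_dotProduct, Equiv.swap_apply_def]
  simp only [Pi.add_apply, Pi.smul_apply, Pi.sub_apply, Pi.single_apply, smul_eq_mul]
  split_ifs <;> simp_all

theorem swapHead_out {start : σ → Bool} {drive : σ → ι × ι} {i₀ : ι} {s : ℕ → σ} {N : ℕ}
    (hstart : start (s 0) = true) (hrest : ∀ t < N, start (s (t + 1)) = false) {pos : ℕ → ι}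
    (hpos₀ : pos 0 = i₀)
    (hpos : ∀ t < N, pos (t + 1) = Equiv.swap (drive (s (t + 1))).1 (drive (s (t + 1))).2 (pos t))
    (i : ι) : ∀ t ≤ N, (swapHead start drive i₀ i).out s t = if pos t = i then 1 else 0 := by
  have hrow : ∀ t ≤ N, (swapHead start drive i₀ i).row s (t + 1) = Pi.single (pos t) 1 := by
    intro t
    induction t with
    | zero =>
      intro _
      simp [ScalarHead.row, swapHead, hstart, hpos₀]
    | succ t ih =>
      intro ht
      rw [ScalarHead.row, ih (by omega), hpos t ht, ← reflect_single]
      simp [swapHead, hrest t ht]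
  intro t ht
  rw [ScalarHead.out, hrow t ht]
  simp only [swapHead, single_one_dotProduct, Pi.single_apply]

/-- A head that stores a bit in a slot and retrieves the content of another slot. -/
def slotHead (slot : σ → ι) (bit : σ → Bool) (query : σ → ι) : ScalarHead σ ι where
  beta _ := 1
  k s := Pi.single (slot s) 1
  v s := if bit s then 1 else 0
  q s := Pi.single (query s) 1

theorem slotHead_row_succ (slot : σ → ι) (bit : σ → Bool) (query : σ → ι) (s : ℕ → σ) (t : ℕ)
    (i : ι) : (slotHead slot bit query).row s (t + 1) i =
      if i = slot (s t) then (if bit (s t) then 1 else 0)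
      else (slotHead slot bit query).row s t i := by
  simp only [ScalarHead.row, slotHead, dotProduct_single_one, Pi.add_apply, Pi.smul_apply,
    Pi.single_apply, smul_eq_mul]
  by_cases h : i = slot (s t)
  · simp only [h, if_true]; ring
  · simp only [h, if_false]; ring

/-- Slots are overwritten cyclically, so the slot `j < n` places back still holds what was written
`j` steps ago, or the initial 0 if there was no such step. -/
theorem slotHead_out {n : ℕ} [NeZero n] {slot : σ → ZMod n} {bit : σ → Bool} {s : ℕ → σ} {N : ℕ}
    (hslot : ∀ t ≤ N, slot (s t) = t) (j : ℕ) (hj : j < n) (t : ℕ) (ht : t ≤ N) :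
    (slotHead slot bit (fun s => slot s - j)).out s t =
      if j ≤ t ∧ bit (s (t - j)) then 1 else 0 := by
  have hne : ∀ j : ℕ, 0 < j → j < n → (j : ZMod n) ≠ 0 := fun j h0 hj h =>
    absurd (Nat.le_of_dvd h0 ((ZMod.natCast_eq_zero_iff j n).mp h)) (by omega)
  have hrow : ∀ t ≤ N, ∀ i < n, (slotHead slot bit (fun s => slot s - j)).row s (t + 1)
      ((t : ZMod n) - i) = if i ≤ t ∧ bit (s (t - i)) then 1 else 0 := by
    intro t
    induction t with
    | zero =>
      intro ht i hi
      rw [slotHead_row_succ, hslot 0 ht]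
      rcases Nat.eq_zero_or_pos i with rfl | h0
      · simp
      · simp [hne i h0 hi, ScalarHead.row, h0.ne']
    | succ t ih =>
      intro ht i hi
      rw [slotHead_row_succ, hslot _ ht]
      rcases i with _ | i
      · simp
      · have := ih (by omega) i (by omega)
        rw [if_neg, Nat.cast_succ, Nat.cast_succ, add_sub_add_right_eq_sub, this]
        · simp
        · rw [sub_eq_self]
          exact hne _ i.succ_pos hi
  rw [ScalarHead.out, ← hrow t ht j hj]
  simp [slotHead, hslot t ht]

end Memory

/-! ## Matrix products by rank-one updates -/

section Product

/-- The state update of a scalar head that writes nothing. -/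
def deltaStep {ι : Type} [Fintype ι] (p : ℚ × (ι → ℚ)) (r : ι → ℚ) : ι → ℚ :=
  r + (p.1 * (0 - r ⬝ᵥ p.2)) • p.2

/-- Here `M` is the distortion accumulated so far, and `u = M⁻¹ a` compensates for it. The new
distortion `M (1 + u uᵀ)` remains invertible because its determinant is that of `M` times `1 + u ⬝ᵥ
u`, and `u ⬝ᵥ u ≥ 0` over `ℚ`. -/
theorem exists_dilation {n : Type} [Fintype n] [DecidableEq n] (M : Matrix n n ℚ)
    (hM : IsUnit M.det) (a : n → ℚ) :
    ∃ u : n → ℚ, (∀ p, (p ᵥ* M) ⬝ᵥ u = p ⬝ᵥ a) ∧ ∃ M' : Matrix n n ℚ, IsUnit M'.det ∧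
      ∀ p, p ᵥ* M' = p ᵥ* M + ((p ᵥ* M) ⬝ᵥ u) • u := by
  refine ⟨M⁻¹ *ᵥ a, fun p => ?_, M * (1 + vecMulVec (M⁻¹ *ᵥ a) (M⁻¹ *ᵥ a)), ?_, fun p => ?_⟩
  · rw [← dotProduct_mulVec, mulVec_mulVec, Matrix.mul_nonsing_inv _ hM, one_mulVec]
  · rw [Matrix.det_mul]
    refine hM.mul (isUnit_iff_ne_zero.mpr ?_)
    rw [vecMulVec_eq Unit, det_one_add_replicateCol_mul_replicateRow]
    have : 0 ≤ (M⁻¹ *ᵥ a) ⬝ᵥ (M⁻¹ *ᵥ a) :=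
      Finset.sum_nonneg fun i _ => mul_self_nonneg _
    positivity
  · rw [← vecMul_vecMul, Matrix.vecMul_add, vecMul_one, vecMul_vecMulVec]

/-- Three vectors such that successive dilations along them pick up the entries of `p ᵥ* A`. -/
theorem exists_dilations (A : Matrix (Fin 3) (Fin 3) ℚ) :
    ∃ u : Fin 3 → Fin 3 → ℚ, ∀ p : Fin 3 → ℚ, ∃ p₁ p₂ : Fin 3 → ℚ,
      p₁ = p + (p ⬝ᵥ u 0) • u 0 ∧ p₂ = p₁ + (p₁ ⬝ᵥ u 1) • u 1 ∧
      p ⬝ᵥ u 0 = (p ᵥ* A) 0 ∧ p₁ ⬝ᵥ u 1 = (p ᵥ* A) 1 ∧ p₂ ⬝ᵥ u 2 = (p ᵥ* A) 2 := by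
  obtain ⟨u₀, h₀, M₁, hM₁, e₁⟩ := exists_dilation 1 (by simp) (fun i => A i 0)
  obtain ⟨u₁, h₁, M₂, hM₂, e₂⟩ := exists_dilation M₁ hM₁ (fun i => A i 1)
  obtain ⟨u₂, h₂, -⟩ := exists_dilation M₂ hM₂ (fun i => A i 2)
  simp only [vecMul_one] at h₀ e₁
  exact ⟨![u₀, u₁, u₂], fun p => ⟨p ᵥ* M₁, p ᵥ* M₂, e₁ p, e₂ p, h₀ p, h₁ p, h₂ p⟩⟩

/-- The vectors of `exists_dilations`. -/
noncomputable def dilation (A : Matrix (Fin 3) (Fin 3) ℚ) : Fin 3 → Fin 3 → ℚ :=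
  (exists_dilations A).choose

/-- The nine rank-one updates, indexed by the time modulo `9`, that multiply the left half of a
state by `A`: three accumulate the product in the right half, three clear the left half, and three
move the product back. -/
noncomputable def productStep (A : Matrix (Fin 3) (Fin 3) ℚ) : ℕ → ℚ × (Fin 3 ⊕ Fin 3 → ℚ)
  | 1 => (-1, Sum.elim (dilation A 0) (Pi.single 0 1))
  | 2 => (-1, Sum.elim (dilation A 1) (Pi.single 1 1))
  | 3 => (-1, Sum.elim (dilation A 2) (Pi.single 2 1))
  | 4 => (1, Sum.elim (Pi.single 0 1) 0)
  | 5 => (1, Sum.elim (Pi.single 1 1) 0)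
  | 6 => (1, Sum.elim (Pi.single 2 1) 0)
  | 7 => (1, Sum.elim (Pi.single 0 1) (-Pi.single 0 1))
  | 8 => (1, Sum.elim (Pi.single 1 1) (-Pi.single 1 1))
  | _ => (1, Sum.elim (Pi.single 2 1) (-Pi.single 2 1))

/-- By symmetry of `k kᵀ`, writing `p ⬝ᵥ u` to the right half also dilates the left half along `u`.
This is why the vectors of `exists_dilations` depend on one another. -/
theorem deltaStep_accumulate (p q u : Fin 3 → ℚ) (i : Fin 3) (hq : q i = 0) :
    deltaStep (-1, Sum.elim u (Pi.single i 1)) (Sum.elim p q) =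
      Sum.elim (p + (p ⬝ᵥ u) • u) (q + Pi.single i (p ⬝ᵥ u)) := by
  ext (j | j)
  · simp [deltaStep, hq]
  · by_cases h : j = i
    · subst h; simp [deltaStep, hq]
    · simp [deltaStep, h]

theorem deltaStep_clear (p q : Fin 3 → ℚ) (i : Fin 3) :
    deltaStep (1, Sum.elim (Pi.single i 1) 0) (Sum.elim p q) =
      Sum.elim (Function.update p i 0) q := by
  ext (j | j)
  · by_cases h : j = i
    · subst h; simp [deltaStep]
    · simp [deltaStep, h]
  · simp [deltaStep]

/-- This is again the swap of two coordinates, one of which has been cleared. -/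
theorem deltaStep_move (p q : Fin 3 → ℚ) (i : Fin 3) (hp : p i = 0) :
    deltaStep (1, Sum.elim (Pi.single i 1) (-Pi.single i 1)) (Sum.elim p q) =
      Sum.elim (Function.update p i (q i)) (Function.update q i 0) := by
  ext (j | j)
  · by_cases h : j = i
    · subst h; simp [deltaStep, hp]
    · simp [deltaStep, h]
  · by_cases h : j = i
    · subst h; simp [deltaStep, hp]
    · simp [deltaStep, h]

theorem deltaStep_productStep (A : Matrix (Fin 3) (Fin 3) ℚ) (p : Fin 3 → ℚ) :
    deltaStep (productStep A 0) (deltaStep (productStep A 8) (deltaStep (productStep A 7)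
      (deltaStep (productStep A 6) (deltaStep (productStep A 5) (deltaStep (productStep A 4)
      (deltaStep (productStep A 3) (deltaStep (productStep A 2) (deltaStep (productStep A 1)
      (Sum.elim p 0))))))))) = Sum.elim (p ᵥ* A) 0 := by
  obtain ⟨p₁, p₂, e₁, e₂, h₀, h₁, h₂⟩ := (exists_dilations A).choose_spec p
  change p₁ = p + (p ⬝ᵥ dilation A 0) • dilation A 0 at e₁
  change p₂ = p₁ + (p₁ ⬝ᵥ dilation A 1) • dilation A 1 at e₂
  change p ⬝ᵥ dilation A 0 = _ at h₀
  change p₁ ⬝ᵥ dilation A 1 = _ at h₁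
  change p₂ ⬝ᵥ dilation A 2 = _ at h₂
  simp only [productStep]
  rw [deltaStep_accumulate _ _ _ _ (by simp), ← e₁, h₀,
    deltaStep_accumulate _ _ _ _ (by simp), ← e₂, h₁,
    deltaStep_accumulate _ _ _ _ (by simp), h₂,
    deltaStep_clear, deltaStep_clear, deltaStep_clear,
    deltaStep_move _ _ _ (by simp), deltaStep_move _ _ _ (by simp),
    deltaStep_move _ _ _ (by simp)]
  ext (j | j) <;> fin_cases j <;> simp

variable {σ : Type}

/-- A head whose state row runs through the products of a sequence of matrices, delayed by one
block; its output is the entry `(i, j)` of the product at the end of each block, `0` elsewhere. -/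
noncomputable def productHead (start : σ → Bool) (phase : σ → ZMod 9)
    (prev cur : σ → Matrix (Fin 3) (Fin 3) ℚ) (i j : Fin 3) : ScalarHead σ (Fin 3 ⊕ Fin 3) where
  beta s := if start s then 1 else (productStep (prev s) (phase s).val).1
  k s := if start s then Sum.elim (Pi.single i 1) 0 else (productStep (prev s) (phase s).val).2
  v s := if start s then 1 else 0
  q s := if phase s = 0 then Sum.elim (fun l => cur s l j) 0 else 0

/-- The product `B 0 * B 1 * ⋯ * B n`. -/
def partialProduct (B : ℕ → Matrix (Fin 3) (Fin 3) ℚ) : ℕ → Matrix (Fin 3) (Fin 3) ℚ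
  | 0 => B 0
  | n + 1 => partialProduct B n * B (n + 1)

variable {start : σ → Bool} {phase : σ → ZMod 9} {prev cur : σ → Matrix (Fin 3) (Fin 3) ℚ}
  {s : ℕ → σ} {N : ℕ} {B : ℕ → Matrix (Fin 3) (Fin 3) ℚ}

theorem productHead_out_of_ne {t : ℕ} (hphase : phase (s t) ≠ 0) (i j : Fin 3) :
    (productHead start phase prev cur i j).out s t = 0 := by
  simp [ScalarHead.out, productHead, hphase]

/-- Invariant at position `9 * n`: the left half is row `i` of the product of `B 0`, …, `B (n - 1)`
and the right half is zero. The query supplies column `j` of `B n`. Only the first three steps of a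
block consult the previous matrix, hence the bound `l < 3`. -/
theorem productHead_out (hstart : start (s 0) = true)
    (hrest : ∀ t < N, start (s (t + 1)) = false) (hphase : ∀ t ≤ N, phase (s t) = t)
    (hprev : ∀ n, ∀ l < 3, 9 * n + 1 + l ≤ N → prev (s (9 * n + 1 + l)) = B n)
    (hcur : ∀ n, 9 * n ≤ N → cur (s (9 * n)) = B n) (i j : Fin 3) (n : ℕ) (hn : 9 * n ≤ N) :
    (productHead start phase prev cur i j).out s (9 * n) = partialProduct B n i j := by
  set h := productHead start phase prev cur i j with hh
  have hstep : ∀ n, ∀ l < 9, 9 * n + 1 + l ≤ N → h.row s (9 * n + 1 + l + 1) =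
      deltaStep (productStep (B n) ((1 + l) % 9)) (h.row s (9 * n + 1 + l)) := by
    intro n l hl hN
    have hs : start (s (9 * n + 1 + l)) = false := by
      have := hrest (9 * n + l) (by omega)
      rwa [show 9 * n + l + 1 = 9 * n + 1 + l by omega] at this
    have hph : (phase (s (9 * n + 1 + l))).val = (1 + l) % 9 := by
      rw [hphase _ hN, ZMod.val_natCast]
      omega
    have hA : productStep (prev (s (9 * n + 1 + l))) ((1 + l) % 9) =
        productStep (B n) ((1 + l) % 9) := by
      by_cases hl3 : l < 3
      · rw [hprev n l hl3 hN]
      -- The clearing and moving steps do not depend on the matrix.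
      · interval_cases l <;> first | omega | rfl
    rw [ScalarHead.row, ← hA]
    simp [hh, productHead, hs, hph, deltaStep]
  have hrow : ∀ n, 9 * n ≤ N → ∃ p : Fin 3 → ℚ, h.row s (9 * n + 1) = Sum.elim p 0 ∧
      p ᵥ* B n = partialProduct B n i := by
    intro n
    induction n with
    | zero =>
      intro _
      refine ⟨Pi.single i 1, ?_, ?_⟩
      · simp [ScalarHead.row, hh, productHead, hstart]
      · rw [single_one_vecMul]; rfl
    | succ n ih =>
      intro hN
      obtain ⟨p, hp, hpB⟩ := ih (by omega)
      refine ⟨p ᵥ* B n, ?_, ?_⟩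
      · rw [← deltaStep_productStep, ← hp]
        have e0 := hstep n 0 (by omega) (by omega)
        have e1 := hstep n 1 (by omega) (by omega)
        have e2 := hstep n 2 (by omega) (by omega)
        have e3 := hstep n 3 (by omega) (by omega)
        have e4 := hstep n 4 (by omega) (by omega)
        have e5 := hstep n 5 (by omega) (by omega)
        have e6 := hstep n 6 (by omega) (by omega)
        have e7 := hstep n 7 (by omega) (by omega)
        have e8 := hstep n 8 (by omega) (by omega)
        simp only [add_assoc, Nat.reduceAdd, Nat.reduceMod] at e0 e1 e2 e3 e4 e5 e6 e7 e8 ⊢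
        rw [show 9 * (n + 1) + 1 = 9 * n + 10 by omega, e8, e7, e6, e5, e4, e3, e2, e1, e0]
      · rw [hpB, partialProduct]
        rfl
  obtain ⟨p, hp, hpB⟩ := hrow n hn
  have h0 : phase (s (9 * n)) = 0 := by
    rw [hphase _ hn, ZMod.natCast_eq_zero_iff]
    exact dvd_mul_right 9 n
  rw [ScalarHead.out, hp, ← hpB]
  simp [hh, productHead, h0, hcur n hn, vecMul, dotProduct]

end Product

/-! ## Encoded matrix sequences -/

section Encoding

theorem encodeStream_cons (A : Matrix (Fin 3) (Fin 3) SignType)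
    (As : List (Matrix (Fin 3) (Fin 3) SignType)) :
    encodeStream (A :: As) = encodeMatrix A ++ encodeStream As := rfl

theorem length_encodeStream (As : List (Matrix (Fin 3) (Fin 3) SignType)) :
    (encodeStream As).length = 9 * As.length := by
  induction As with
  | nil => rfl
  | cons A As ih =>
    rw [encodeStream_cons, List.length_append, ih, List.length_cons]
    simp only [encodeMatrix, List.length_cons, List.length_nil]
    omega

theorem getElem?_encodeStream (As : List (Matrix (Fin 3) (Fin 3) SignType)) (b : ℕ)
    (hb : b < As.length) (r c : Fin 3) :
    (encodeStream As)[9 * b + (3 * r.val + c.val)]? = some (As[b] r c) := by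
  induction As generalizing b with
  | nil => simp at hb
  | cons A As ih =>
    rw [encodeStream_cons]
    rcases b with _ | b
    · rw [List.getElem?_append_left (by simp [encodeMatrix]; omega)]
      fin_cases r <;> fin_cases c <;> rfl
    · rw [List.getElem?_append_right (by simp [encodeMatrix]; omega), List.getElem_cons_succ,
        ← ih b (by simpa using hb)]
      congr 1
      simp only [encodeMatrix, List.length_cons, List.length_nil]
      omega

theorem exists_eq_encodeStream (n : ℕ) (w : List SignType) (hw : w.length = 9 * n) :
    ∃ As, w = encodeStream As := by
  induction n generalizing w with
  | zero => exact ⟨[], List.eq_nil_of_length_eq_zero hw⟩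
  | succ n ih =>
    match w, hw with
    | a :: b :: c :: d :: e :: f :: g :: h :: i :: w, hw =>
      obtain ⟨As, rfl⟩ := ih w (by simp only [List.length_cons] at hw; omega)
      exact ⟨!![a, b, c; d, e, f; g, h, i] :: As, rfl⟩

theorem tokenAt_succ (w : List SignType) (t : ℕ) : tokenAt w (t + 1) = w[t]? := by
  change (w.map some).getD t none = _
  rw [List.getD_eq_getElem?_getD, List.getElem?_map]
  cases w[t]? <;> rfl

/-- The entry `(r, c)` that a token stands for; a missing token stands for the identity matrix. -/
def entryValue (o : Option SignType) (r c : Fin 3) : ℚ :=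
  o.elim ((1 : Matrix (Fin 3) (Fin 3) ℚ) r c) fun a => ((a : ℤ) : ℚ)

/-- The matrix in the `n`-th block of nine tokens; the block before the first one is taken to hold
the identity matrix. -/
def blockMatrix (w : List SignType) (n : ℕ) : Matrix (Fin 3) (Fin 3) ℚ :=
  Matrix.of fun r c => entryValue
    (if n = 0 then none else tokenAt w (9 * (n - 1) + 1 + (3 * r.val + c.val))) r c

theorem partialProduct_blockMatrix (As : List (Matrix (Fin 3) (Fin 3) SignType)) (n : ℕ)
    (hn : n ≤ As.length) : partialProduct (blockMatrix (encodeStream As)) n =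
      (iteratedProduct (As.take n)).map (Int.castRingHom ℚ) := by
  induction n with
  | zero =>
    ext r c
    simp [partialProduct, blockMatrix, entryValue, iteratedProduct, Matrix.one_apply]
  | succ n ih =>
    have hn' : n < As.length := hn
    have hblock : blockMatrix (encodeStream As) (n + 1) =
        (As[n].map fun s : SignType => (s : ℤ)).map (Int.castRingHom ℚ) := by
      ext r c
      simp only [blockMatrix, Matrix.of_apply, n.succ_ne_zero, if_false, Nat.add_sub_cancel]
      rw [show 9 * n + 1 + (3 * r.val + c.val) = 9 * n + (3 * r.val + c.val) + 1 by omega,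
        tokenAt_succ, getElem?_encodeStream As n hn' r c]
      rfl
    rw [partialProduct, ih (by omega), hblock, ← Matrix.map_mul,
      List.take_succ_eq_append_getElem hn']
    simp only [iteratedProduct, List.map_append, List.prod_append, List.map_cons, List.map_nil,
      List.prod_singleton]

end Encoding

/-! ## The network -/

section Construction

/-- Symbols: the token, the parity and residues of the position, the last twelve tokens. -/
abbrev Symbol : Type :=
  Option SignType × Bool × ZMod 12 × ZMod 9 × (Fin 12 → Option SignType)

/-- Output slots: the tokens of the window, and nine further values. -/
abbrev Slot : Type := (Fin 12 × SignType) ⊕ (Fin 3 × Fin 3)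

/-- The beginning-of-sequence symbol. -/
def isStart (s : Symbol) : Bool := s.1.isNone

/-! ### Counters driven by transpositions -/

/-- The three states of a counter. -/
def counterState : Fin 3 → ZMod 12 := ![0, 1, 2]

/-- The state of the counter that is toggled at every step. -/
def parityState (t : ℕ) : ZMod 12 := if t % 2 = 1 then 1 else 0

/-- The state of the counter subject to alternating transpositions `(0 1)`, `(1 2)`. -/
def alternatingState (t : ℕ) : ZMod 12 :=
  if t % 6 = 1 ∨ t % 6 = 4 then 1 else if t % 6 = 2 ∨ t % 6 = 3 then 2 else 0

/-- The state of the counter that is toggled at every odd step. -/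
def halfState (t : ℕ) : ZMod 12 := if t % 4 = 1 ∨ t % 4 = 2 then 1 else 0

/-- The state of the counter that undergoes a 3-cycle every three steps. -/
def cycleState (t : ℕ) : ZMod 12 :=
  if t % 9 = 1 ∨ t % 9 = 5 ∨ t % 9 = 6 then 1
  else if t % 9 = 2 ∨ t % 9 = 3 ∨ t % 9 = 4 then 2 else 0

theorem parityState_succ (t : ℕ) : parityState (t + 1) = Equiv.swap 0 1 (parityState t) := by
  unfold parityState
  have : t % 2 < 2 := Nat.mod_lt _ (by norm_num)
  rw [Nat.add_mod]
  interval_cases t % 2 <;> decide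

theorem alternatingState_succ (t : ℕ) : alternatingState (t + 1) =
    if (t + 1) % 2 = 1 then Equiv.swap 0 1 (alternatingState t)
    else Equiv.swap 1 2 (alternatingState t) := by
  unfold alternatingState
  have : t % 6 < 6 := Nat.mod_lt _ (by norm_num)
  rw [← Nat.mod_mod_of_dvd (t + 1) (by norm_num : 2 ∣ 6), Nat.add_mod t 1 6]
  interval_cases t % 6 <;> decide

theorem halfState_succ (t : ℕ) : halfState (t + 1) =
    if (t + 1) % 2 = 1 then Equiv.swap 0 1 (halfState t) else halfState t := by
  unfold halfState
  have : t % 4 < 4 := Nat.mod_lt _ (by norm_num)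
  rw [← Nat.mod_mod_of_dvd (t + 1) (by norm_num : 2 ∣ 4), Nat.add_mod t 1 4]
  interval_cases t % 4 <;> decide

theorem cycleState_succ (t : ℕ) : cycleState (t + 1) =
    if (t + 1) % 3 = 1 then Equiv.swap 0 1 (cycleState t)
    else if (t + 1) % 3 = 2 then Equiv.swap 1 2 (cycleState t) else cycleState t := by
  unfold cycleState
  have : t % 9 < 9 := Nat.mod_lt _ (by norm_num)
  rw [← Nat.mod_mod_of_dvd (t + 1) (by norm_num : 3 ∣ 9), Nat.add_mod t 1 9]
  interval_cases t % 9 <;> decide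

/-! ### Recovering residues from counter outputs -/

/-- The outputs of the counters that determine the position modulo `12`, given its parity. -/
def bitsTwelve (t : ℕ) (p : Fin 3 × Fin 3) : Bool :=
  if p.1 = 0 then decide (alternatingState t = counterState p.2)
  else decide (halfState t = counterState p.2)

/-- The outputs of the counter that determines the position modulo `9`, given it modulo `3`. -/
def bitsNine (t : ℕ) (p : Fin 3 × Fin 3) : Bool := decide (cycleState t = counterState p.2)

theorem exists_decoder {α : Type} (n : ℕ) (f : ℕ → α)
    (hf : ∀ a b, f a = f b → a % n = b % n) : ∃ D : α → ZMod n, ∀ t, D (f t) = t := by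
  classical
  refine ⟨fun x => if h : ∃ t, f t = x then (h.choose : ZMod n) else 0, fun t => ?_⟩
  have h : ∃ t', f t' = f t := ⟨t, rfl⟩
  simp only [dif_pos h]
  exact (ZMod.natCast_eq_natCast_iff' _ _ _).mpr (hf _ _ h.choose_spec)

/-- Together with parity, the alternating counter determines the position modulo 6 and the half
counter determines it modulo 4; the least common multiple is 12. -/
theorem exists_decoder_twelve : ∃ D : Bool × (Fin 3 × Fin 3 → Bool) → ZMod 12,
    ∀ t : ℕ, D (decide (t % 2 = 1), bitsTwelve t) = t := by
  refine exists_decoder 12 (fun t => (decide (t % 2 = 1), bitsTwelve t)) fun a b h => ?_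
  have h1 : ∀ t, alternatingState t = 1 ↔ t % 6 = 1 ∨ t % 6 = 4 := fun t => by
    unfold alternatingState
    split_ifs with h h' <;> simp [h] <;> decide
  have h2 : ∀ t, alternatingState t = 2 ↔ t % 6 = 2 ∨ t % 6 = 3 := fun t => by
    unfold alternatingState
    split_ifs with h h'
    · exact iff_of_false (by decide) (by omega)
    · simp [h']
    · exact iff_of_false (by decide) h'
  have h3 : ∀ t, halfState t = 1 ↔ t % 4 = 1 ∨ t % 4 = 2 := fun t => by
    unfold halfState
    split_ifs with h <;> simp [h]
    decide
  obtain ⟨hpar, hbits⟩ := Prod.mk.inj h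
  have e1 := congrFun hbits (0, 1)
  have e2 := congrFun hbits (0, 2)
  have e3 := congrFun hbits (1, 1)
  rw [Bool.eq_iff_iff] at e1 e2 e3
  simp [bitsTwelve, counterState, h1, h2, h3] at e1 e2 e3 hpar
  omega

/-- The residue modulo 12 gives the one modulo 3. Within each class modulo 3, the 3-cycle takes
three different states over a period of 9. -/
theorem exists_decoder_nine : ∃ D : ZMod 12 × (Fin 3 × Fin 3 → Bool) → ZMod 9,
    ∀ t : ℕ, D ((t : ZMod 12), bitsNine t) = t := by
  refine exists_decoder 9 (fun t => ((t : ZMod 12), bitsNine t)) fun a b h => ?_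
  have h1 : ∀ t, cycleState t = 1 ↔ t % 9 = 1 ∨ t % 9 = 5 ∨ t % 9 = 6 := fun t => by
    unfold cycleState
    split_ifs with h h' <;> simp [h] <;> decide
  have h2 : ∀ t, cycleState t = 2 ↔ t % 9 = 2 ∨ t % 9 = 3 ∨ t % 9 = 4 := fun t => by
    unfold cycleState
    split_ifs with h h'
    · exact iff_of_false (by decide) (by omega)
    · simp [h']
    · exact iff_of_false (by decide) h'
  obtain ⟨hmod, hbits⟩ := Prod.mk.inj h
  rw [ZMod.natCast_eq_natCast_iff'] at hmod
  have e1 := congrFun hbits (0, 1)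
  have e2 := congrFun hbits (0, 2)
  rw [Bool.eq_iff_iff] at e1 e2
  simp [bitsNine, counterState, h1, h2] at e1 e2
  omega

/-! ### Symbols and heads of the four layers -/

variable (w : List SignType)

/-- The token `j` positions before position `t`, if there is one. -/
def windowAt (t : ℕ) (j : Fin 12) : Option SignType :=
  if j.val ≤ t then tokenAt w (t - j) else none

/-- The symbol of a token that carries no further information. -/
def tokenSymbol (o : Option SignType) : Symbol := (o, false, 0, 0, fun _ => none)

/-- The symbols after the first layer. -/
def paritySymbol (t : ℕ) : Symbol := (tokenAt w t, decide (t % 2 = 1), 0, 0, fun _ => none)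

/-- The symbols after the second layer. -/
def residueSymbol (t : ℕ) : Symbol := (tokenAt w t, decide (t % 2 = 1), t, 0, fun _ => none)

/-- The symbols after the third layer. -/
def windowSymbol (t : ℕ) : Symbol := (tokenAt w t, decide (t % 2 = 1), t, t, windowAt w t)

theorem isNone_tokenAt_succ {t : ℕ} (ht : t < w.length) : (tokenAt w (t + 1)).isNone = false := by
  simp [tokenAt_succ, ht]

/-- The heads of the first layer. -/
def parityHead (_ : Slot) : ScalarHead Symbol (ZMod 12) :=
  swapHead isStart (fun _ => (0, 1)) 0 1

/-- The heads of the second layer. -/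
def residueHead : Slot → ScalarHead Symbol (ZMod 12)
  | Sum.inl _ => parityHead (Sum.inr 0)
  | Sum.inr p =>
    if p.1 = 0 then
      swapHead isStart (fun s => if s.2.1 then (0, 1) else (1, 2)) 0 (counterState p.2)
    else swapHead isStart (fun s => if s.2.1 then (0, 1) else (0, 0)) 0 (counterState p.2)

/-- The heads of the third layer. -/
def windowHead : Slot → ScalarHead Symbol (ZMod 12)
  | Sum.inl p => slotHead (fun s => s.2.2.1) (fun s => s.1 = some p.2)
      (fun s => s.2.2.1 - (p.1.val : ℕ))
  | Sum.inr p => swapHead isStart (fun s => if s.2.2.1.val % 3 = 1 then (0, 1)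
      else if s.2.2.1.val % 3 = 2 then (1, 2) else (0, 0)) 0 (counterState p.2)

/-- The matrix in the preceding block, in the first three positions of a block. -/
def prevMatrix (s : Symbol) : Matrix (Fin 3) (Fin 3) ℚ :=
  Matrix.of fun r c => entryValue
    (s.2.2.2.2 (Fin.ofNat 12 ((s.2.2.2.1 - 1).val + 9 - (3 * r.val + c.val)))) r c

/-- The matrix in the current block, at the end of a block. -/
def currentMatrix (s : Symbol) : Matrix (Fin 3) (Fin 3) ℚ :=
  Matrix.of fun r c => entryValue
    (s.2.2.2.2 (Fin.ofNat 12 (8 - (3 * r.val + c.val)))) r c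

/-- The heads of the last layer. -/
noncomputable def entryHead (p : Fin 3 × Fin 3) : ScalarHead Symbol (Fin 3 ⊕ Fin 3) :=
  productHead isStart (fun s => s.2.2.2.1) prevMatrix currentMatrix p.1 p.2

theorem parityHead_out (s : ℕ → Symbol) (hs : ∀ t, (s t).1 = tokenAt w t) (t : ℕ)
    (ht : t ≤ w.length) (h : Slot) :
    (parityHead h).out s t = if decide (t % 2 = 1) then 1 else 0 := by
  refine (swapHead_out (N := w.length) (pos := parityState) (by simp [isStart, hs, tokenAt])
    (fun t ht => by simp [isStart, hs, isNone_tokenAt_succ w ht]) (by simp [parityState])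
    (fun t _ => parityState_succ t) 1 t ht).trans ?_
  by_cases h : t % 2 = 1 <;> simp [parityState, h]
  decide

theorem residueHead_out (t : ℕ) (ht : t ≤ w.length) (h : Slot) :
    (residueHead h).out (paritySymbol w) t =
      if (Sum.elim (fun _ => decide (t % 2 = 1)) (bitsTwelve t) h : Bool) then 1 else 0 := by
  rcases h with _ | p
  · exact parityHead_out w _ (fun _ => rfl) t ht (Sum.inr 0)
  have hstart : isStart (paritySymbol w 0) = true := rfl
  have hrest : ∀ t < w.length, isStart (paritySymbol w (t + 1)) = false :=
    fun t ht => isNone_tokenAt_succ w ht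
  by_cases hp : p.1 = 0
  · simp only [residueHead, hp, if_true, Sum.elim_inr, bitsTwelve, decide_eq_true_eq]
    refine swapHead_out hstart hrest (pos := alternatingState) rfl (fun t _ => ?_) _ t ht
    rw [alternatingState_succ]
    by_cases h : (t + 1) % 2 = 1 <;> simp [paritySymbol, h]
  · simp only [residueHead, hp, if_false, Sum.elim_inr, bitsTwelve, decide_eq_true_eq]
    refine swapHead_out hstart hrest (pos := halfState) rfl (fun t _ => ?_) _ t ht
    rw [halfState_succ]
    by_cases h : (t + 1) % 2 = 1 <;> simp [paritySymbol, h]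

theorem windowHead_out (t : ℕ) (ht : t ≤ w.length) (h : Slot) :
    (windowHead h).out (residueSymbol w) t =
      if (Sum.elim (fun p => decide (windowAt w t p.1 = some p.2)) (bitsNine t) h : Bool)
        then 1 else 0 := by
  rcases h with p | p
  · refine (slotHead_out (slot := fun s : Symbol => s.2.2.1) (s := residueSymbol w)
      (N := w.length) (fun _ _ => rfl) p.1 p.1.isLt t ht).trans ?_
    simp only [residueSymbol, Sum.elim_inl, windowAt]
    by_cases h : p.1.val ≤ t <;>
      simp only [h, true_and, false_and, if_true, if_false, reduceCtorEq, decide_false,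
        Bool.false_eq_true]
    congr 1
  · have hstart : isStart (residueSymbol w 0) = true := rfl
    have hrest : ∀ t < w.length, isStart (residueSymbol w (t + 1)) = false :=
      fun t ht => isNone_tokenAt_succ w ht
    simp only [windowHead, Sum.elim_inr, bitsNine, decide_eq_true_eq]
    refine swapHead_out hstart hrest (pos := cycleState) rfl (fun t _ => ?_) _ t ht
    have hval : (residueSymbol w (t + 1)).2.2.1.val % 3 = (t + 1) % 3 := by
      change ((t + 1 : ℕ) : ZMod 12).val % 3 = _
      rw [ZMod.val_natCast, Nat.mod_mod_of_dvd _ (by norm_num)]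
    rw [cycleState_succ, hval]
    by_cases h : (t + 1) % 3 = 1
    · simp [h]
    · by_cases h' : (t + 1) % 3 = 2 <;> simp [h, h']

theorem entryHead_out (n : ℕ) (hn : w.length = 9 * n) (p : Fin 3 × Fin 3) :
    (entryHead p).out (windowSymbol w) w.length = partialProduct (blockMatrix w) n p.1 p.2 := by
  have hrest : ∀ t < w.length, isStart (windowSymbol w (t + 1)) = false :=
    fun t ht => isNone_tokenAt_succ w ht
  rw [hn] at hrest ⊢
  refine productHead_out (N := 9 * n) rfl hrest (fun _ _ => rfl) (fun n l hl _ => ?_)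
    (fun n _ => ?_) p.1 p.2 n le_rfl
  · ext r c
    have hval : ((windowSymbol w (9 * n + 1 + l)).2.2.2.1 - 1).val = l := by
      change (((9 * n + 1 + l : ℕ) : ZMod 9) - 1).val = l
      have : ((9 * n + 1 + l : ℕ) : ZMod 9) - 1 = ((9 * n + l : ℕ) : ZMod 9) := by
        push_cast; ring
      rw [this, ZMod.val_natCast]
      omega
    simp only [prevMatrix, blockMatrix, Matrix.of_apply, hval]
    congr 1
    simp only [windowSymbol, windowAt, Fin.ofNat]
    -- As `l ≤ 2`, the lookback is at most 11, so a window of twelve tokens is enough.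
    rw [Nat.mod_eq_of_lt (by omega : l + 9 - (3 * r.val + c.val) < 12)]
    rcases n with _ | n
    · rw [if_pos rfl]
      split_ifs with h
      -- Before the first block the lookback either hits `$` or leaves the string; both give `none`,
      -- hence an entry of the identity.
      · rw [show 9 * 0 + 1 + l - (l + 9 - (3 * r.val + c.val)) = 0 by omega]
        rfl
      · rfl
    · rw [if_pos (by omega), if_neg n.succ_ne_zero]
      congr 1
      omega
  · ext r c
    simp only [currentMatrix, blockMatrix, Matrix.of_apply]
    congr 1
    simp only [windowSymbol, windowAt, Fin.ofNat]
    rw [Nat.mod_eq_of_lt (by omega : 8 - (3 * r.val + c.val) < 12)]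
    rcases n with _ | n
    · rw [if_pos rfl]
      split_ifs with h
      · rw [show 9 * 0 - (8 - (3 * r.val + c.val)) = 0 by omega]
        rfl
      · rfl
    · rw [if_pos (by omega), if_neg n.succ_ne_zero]
      congr 1
      omega

theorem entryHead_out_of_not_dvd (hw : ¬ 9 ∣ w.length) (p : Fin 3 × Fin 3) :
    (entryHead p).out (windowSymbol w) w.length = 0 :=
  productHead_out_of_ne (fun h => hw ((ZMod.natCast_eq_zero_iff _ _).mp h)) _ _

/-- The token recorded by the three bits of a window position. -/
def decodeToken (y : SignType → Bool) : Option SignType :=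
  if y 0 then some 0 else if y 1 then some 1 else if y (-1) then some (-1) else none

theorem decodeToken_decide (o : Option SignType) :
    decodeToken (fun c => decide (o = some c)) = o := by
  rcases o with _ | a
  · rfl
  · cases a <;> rfl

/-! ### Assembling the network -/

theorem exists_network (Head : ℕ → ℕ → Type) [HeadType Head] (hH : RealizesScalarHeads Head) :
    ∃ (net : Network Head SignType 4) (R : Matrix (Fin 3 × Fin 3) (Fin net.dim) ℚ),
      ∀ (m : ℕ) (w : List SignType) (p : Fin 3 × Fin 3),
        R p ⬝ᵥ net.output m w = (entryHead p).out (windowSymbol w) w.length := by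
  classical
  obtain ⟨D₁₂, hD₁₂⟩ := exists_decoder_twelve
  obtain ⟨D₉, hD₉⟩ := exists_decoder_nine
  obtain ⟨L₁, hL₁⟩ := exists_layer_update Head hH parityHead
    (fun s y => (s.1, y (Sum.inr 0), s.2.2))
  obtain ⟨L₂, hL₂⟩ := exists_layer_update Head hH residueHead
    (fun s y => (s.1, s.2.1, D₁₂ (s.2.1, fun p => y (Sum.inr p)), s.2.2.2))
  obtain ⟨L₃, hL₃⟩ := exists_layer_update Head hH windowHead
    (fun s y => (s.1, s.2.1, s.2.2.1, D₉ (s.2.2.1, fun p => y (Sum.inr p)),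
      fun j => decodeToken fun c => y (Sum.inl (j, c))))
  obtain ⟨L₄, hL₄⟩ := exists_layer_output Head hH (σ := Symbol) (H := Slot)
    -- The window slots are not read out after this layer; `entryHead 0` is an arbitrary filler.
    (fun h => Sum.elim (fun _ => entryHead 0) entryHead h)
  refine ⟨{ dim := streamDim Symbol Slot
            embed := fun o => balanced (features (tokenSymbol o) 0)
            layers := ![L₁, L₂, L₃, L₄] },
    Matrix.of fun p => readOutput (σ := Symbol) (H := Slot) (Sum.inr p),
    fun m w p => ?_⟩
  let x₀ : ℕ → Fin (streamDim Symbol Slot) → ℚ := fun t =>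
    balanced (features (tokenSymbol (tokenAt w t)) 0)
  have h₁ : ∀ t ≤ w.length, L₁.apply m x₀ t = balanced (features (paritySymbol w t) 0) :=
    hL₁ m x₀ (fun t => tokenSymbol (tokenAt w t)) (fun t _ => decide (t % 2 = 1)) _
      (fun _ _ => rfl) (fun t ht h => parityHead_out w _ (fun _ => rfl) t ht h)
  have h₂ : ∀ t ≤ w.length, L₂.apply m (L₁.apply m x₀) t =
      balanced (features (residueSymbol w t) 0) := by
    intro t ht
    rw [hL₂ m _ _ _ _ h₁ (residueHead_out w) t ht]
    simp only [paritySymbol, residueSymbol, Sum.elim_inr, hD₁₂]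
  have h₃ : ∀ t ≤ w.length, L₃.apply m (L₂.apply m (L₁.apply m x₀)) t =
      balanced (features (windowSymbol w t) 0) := by
    intro t ht
    rw [hL₃ m _ _ _ _ h₂ (windowHead_out w) t ht]
    simp only [residueSymbol, windowSymbol, Sum.elim_inr, Sum.elim_inl, hD₉, decodeToken_decide]
  have h₄ := hL₄ m _ _ _ h₃ w.length le_rfl
  change readOutput (σ := Symbol) (H := Slot) (Sum.inr p) ⬝ᵥ
    L₄.apply m (L₃.apply m (L₂.apply m (L₁.apply m x₀))) w.length = _
  rw [h₄, readOutput_dotProduct]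
  rfl

theorem exists_solvesIteratedProduct (Head : ℕ → ℕ → Type) [HeadType Head]
    (hH : RealizesScalarHeads Head) :
    ∃ net : Network Head SignType 4, SolvesIteratedProduct net := by
  obtain ⟨net, R, hR⟩ := exists_network Head hH
  have hprod : ∀ m As p, R p ⬝ᵥ net.output m (encodeStream As) =
      (iteratedProduct As p.1 p.2 : ℚ) := by
    intro m As p
    rw [hR, entryHead_out _ _ (length_encodeStream As), partialProduct_blockMatrix As _ le_rfl,
      List.take_length]
    rfl
  refine ⟨net, R, fun m => ⟨fun As i j => hprod m As (i, j), ?_⟩⟩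
  ext w
  change 0 < R (0, 0) ⬝ᵥ net.output m w ↔ ∃ As, w = encodeStream As ∧ 0 < iteratedProduct As 0 0
  constructor
  · intro h
    by_cases hw : 9 ∣ w.length
    · obtain ⟨n, hn⟩ := hw
      obtain ⟨As, rfl⟩ := exists_eq_encodeStream n w hn
      rw [hprod] at h
      exact ⟨As, rfl, by exact_mod_cast h⟩
    -- Off block boundaries the query vanishes, so the readout is 0 and an incomplete string is
    -- rejected.
    · rw [hR, entryHead_out_of_not_dvd w hw] at h
      exact absurd h (lt_irrefl 0)
  · rintro ⟨As, rfl, h⟩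
    rw [hprod]
    exact_mod_cast h

end Construction

end LinearRNN

theorem theorem4 :
    (∃ net : LinearRNN.Network LinearRNN.RWKV7Head SignType 4,
      LinearRNN.SolvesIteratedProduct net) ∧
    (∃ net : LinearRNN.Network LinearRNN.DeltaNetHead SignType 4,
      LinearRNN.SolvesIteratedProduct net) :=
  ⟨LinearRNN.exists_solvesIteratedProduct _ LinearRNN.rwkv7_realizesScalarHeads,
    LinearRNN.exists_solvesIteratedProduct _ LinearRNN.deltaNet_realizesScalarHeads⟩
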